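/- **Setting.** Let $s\ge 0$, let $N_k,K_k\ge 0$ with $N_0=K_0=0$, and put $M_l=\sum_{k=0}^{l}(N_k+K_k)$, $S=\bigcup_{l=1}^{s}[-M_l-N_l,-M_l]$, $S^+=\bigcup_{l=1}^{s}[M_l,M_l+N_l]$, $R^s=[0,\infty)\setminus S^+$, $T=S\cup[0,\infty)$, $O=(-\infty,0)\setminus S$. Let $a:R^s\to\mathbb C$ satisfy $\int_{R^s}|a(t)|\,dt<\infty$, $\int_{R^s}t|a(t)|^2dt<\infty$ and, extended by $0$, belong to $L_2(T)$; put $A(\lambda)=\int_{R^s}a(t)e^{-it\lambda}dt$. A spectral density is a nonnegative integrable function on $\mathbb R$. For spectral densities $f,g$ let $L_2^s(f+g)$ be the closed linear span of $\{e^{it\lambda}:t\in O\}$ in $L_2(\mathbb R,(f+g)\,d\lambda)$ and, for $h\in L_2^s(f+g)$, $$\Delta(h;f,g)=\frac1{2\pi}\int|A-h|^2f\,d\lambda+\frac1{2\pi}\int|h|^2g\,d\lambda ,\qquad \Delta(f,g)=\min_{h\in L_2^s(f+g)}\Delta(h;f,g);$$ the minimizer is denoted $h(f,g)$ (the spectral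 characteristic of the optimal linear estimate of $\int_{R^s}a(t)\xi(-t)dt$ from $\xi(t)+\eta(t)$, $t\in O$, for uncorrelated stationary $\xi,\eta$ with spectral densities $f,g$). For $x\in L_2(T)$ put $\hat x(\lambda)=\int_T x(t)e^{it\lambda}dt$ (Plancherel transform). The operators $\mathbf B,\mathbf R,\mathbf Q$ on $T$ have the kernels (from $u$ to $t$) $$\frac1{2\pi}\int\frac{e^{i\lambda(u-t)}}{f+g}d\lambda,\qquad \frac1{2\pi}\int\frac{e^{-i\lambda(u+t)}f}{f+g}d\lambda,\qquad \frac1{2\pi}\int\frac{e^{-i\lambda(u-t)}fg}{f+g}d\lambda .$$ The first two kernels are generalized functions: $\mathbf Rx=y$ means $y\in L_2(T)$ and $\frac1{2\pi}\int\frac{f}{f+g}\hat x(-\lambda)\overline{\hat\psi(\lambda)}d\lambda=\int_T y\bar\psi$ for all $\psi\in L_2(T)$, and $\mathbf Bx=y$ means $x,y\in L_2(T)$, $\int|\hat x|^2/(f+g)\,d\lambda<\infty$, and $\frac1{2\pi}\int\frac{\hat x\,\overline{\hat\psi}}{f+g}d\lambda=\int_T y\bar\psi$, with an absolutely convergent left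 side, for all $\psi\in L_2(T)$ with $\hat\psi\in L_1(\mathbb R)$. If $f+g>0$ almost everywhere, then $\mathbf B$ is injective. Let $\langle x,y\rangle=\int_T x\bar y$. The pair $(f,g)$ satisfies the minimality condition if $\int|\gamma|^2/(f+g)\,d\lambda<\infty$ for some nontrivial $\gamma(\lambda)=\int_0^\infty\alpha(t)e^{it\lambda}dt$, $\alpha\in L_1(0,\infty)$, of exponential type. **Theorem.** Let $f_1,g_1$ be spectral densities, $\varepsilon_1,\varepsilon_2\in\mathbb R$, and $D=D^1_{\varepsilon_1}\times D^2_{\varepsilon_2}$, where $D^1_{\varepsilon_1}$ is the set of spectral densities $f$ with $\frac1{2\pi}\int|f-f_1|d\lambda\le\varepsilon_1$ and $D^2_{\varepsilon_2}$ is the set of spectral densities $g$ with $\frac1{2\pi}\int|g-g_1|^2d\lambda\le\varepsilon_2$. Let $(f_0,g_0)\in D$ satisfy the minimality condition, let $c_0=(\mathbf B^0)^{-1}\mathbf R^0a$ exist (the superscript $0$ refers to $f_0,g_0$), put $C^0=\hat c_0$, and let $$h_f=\frac{|Ag_0+C^0|^2}{(f_0+g_0)^2},\qquad h_g=\frac{|Af_0-C^0|^2}{(f_0+g_0)^2}$$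 be (essentially) bounded. Suppose that there are constants $\alpha_1,\alpha_2\ge0$ and a function $\Psi$ with $|\Psi|\le1$ and $\Psi(\lambda)=\operatorname{sign}(f_0(\lambda)-f_1(\lambda))$ whenever $f_0(\lambda)\ne f_1(\lambda)$, such that almost everywhere $$|Ag_0+C^0|=(f_0+g_0)\,\Psi\,\alpha_1,\qquad |Af_0-C^0|^2=(f_0+g_0)^2(g_0-g_1)\,\alpha_2,$$ that $\frac1{2\pi}\int|f_0-f_1|d\lambda=\varepsilon_1$ and $\frac1{2\pi}\int|g_0-g_1|^2d\lambda=\varepsilon_2$, and that $(f_0,g_0)$ maximizes $\langle\mathbf Ra,\mathbf B^{-1}\mathbf Ra\rangle+\langle\mathbf Qa,a\rangle$ among the pairs $(f,g)\in D$ that satisfy the minimality condition and for which $\mathbf B^{-1}\mathbf Ra$ exists. Then $(f_0,g_0)$ is least favorable in $D$, that is, $\Delta(f_0,g_0)=\max_{(f,g)\in D}\Delta(f,g)$; and $$h^0=A\frac{f_0}{f_0+g_0}-\frac{C^0}{f_0+g_0}$$ is the optimal spectral characteristic $h(f_0,g_0)$ and is minimax-robust: $h^0\in H_D=\bigcap_{(f,g)\in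 D}L_2^s(f+g)$ and $\max_{(f,g)\in D}\Delta(h^0;f,g)=\min_{h\in H_D}\sup_{(f,g)\in D}\Delta(h;f,g)$. -/

import Mathlib

open MeasureTheory FourierTransform ComplexConjugate
open scoped ENNReal

noncomputable section

namespace MissingFilter

/-! ### Observation times and the functional -/

/-- The endpoints `M_l = ∑_{k=0}^{l} (N_k + K_k)`. -/
def gapEnd (N K : ℕ → ℝ) (l : ℕ) : ℝ := ∑ k ∈ Finset.range (l + 1), (N k + K k)

/-- The set `S = ⋃_{l=1}^{s} [-M_l - N_l, -M_l]` of missing observation times. -/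
def missing (s : ℕ) (N K : ℕ → ℝ) : Set ℝ :=
  ⋃ l ∈ Finset.Icc 1 s, Set.Icc (-gapEnd N K l - N l) (-gapEnd N K l)

/-- The set `S⁺ = ⋃_{l=1}^{s} [M_l, M_l + N_l]`. -/
def missingPos (s : ℕ) (N K : ℕ → ℝ) : Set ℝ :=
  ⋃ l ∈ Finset.Icc 1 s, Set.Icc (gapEnd N K l) (gapEnd N K l + N l)

/-- The set `R^s = [0, ∞) \ S⁺` over which the functional `∫ a(t) ξ(-t) dt` is taken. -/
def functionalSet (s : ℕ) (N K : ℕ → ℝ) : Set ℝ := Set.Ici 0 \ missingPos s N K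

/-- The set `T = S ∪ [0, ∞)`. -/
def timeT (s : ℕ) (N K : ℕ → ℝ) : Set ℝ := missing s N K ∪ Set.Ici 0

/-- The set `ℝ⁻ \ S` of times at which `ξ + η` is observed. -/
def observed (s : ℕ) (N K : ℕ → ℝ) : Set ℝ := Set.Iio 0 \ missing s N K

/-- The function `A(e^{iλ}) = ∫_{E} a(t) e^{-itλ} dt`. -/
def symbolA (E : Set ℝ) (a : ℝ → ℂ) (l : ℝ) : ℂ :=
  ∫ t in E, a t * Complex.exp (-(Complex.I * t * l))

/-! ### Spectral densities -/

/-- A spectral density: a nonnegative integrable function on the line. -/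
def IsSpectralDensity (f : ℝ → ℝ) : Prop := (∀ l, 0 ≤ f l) ∧ Integrable f

/-- The minimality condition `∫ |γ|² / (f + g) < ∞` for some nontrivial function
`γ(λ) = ∫_0^∞ α(t) e^{itλ} dt` of exponential type.  The quotient is taken in `[0, ∞]`, so that it
is infinite where `f + g = 0` and `γ ≠ 0`. -/
def Minimality (f g : ℝ → ℝ) : Prop :=
  ∃ (α : ℝ → ℂ) (Γ : ℂ → ℂ), IntegrableOn α (Set.Ioi 0) ∧ Differentiable ℂ Γ ∧
    (∃ C σ : ℝ, ∀ z, ‖Γ z‖ ≤ C * Real.exp (σ * ‖z‖)) ∧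
    (∀ l : ℝ, Γ l = ∫ t in Set.Ioi (0 : ℝ), α t * Complex.exp (Complex.I * t * l)) ∧
    (∃ l : ℝ, Γ l ≠ 0) ∧
    ∫⁻ l : ℝ, ‖Γ l‖ₑ ^ 2 / ENNReal.ofReal (f l + g l) < ∞

/-- The `ε`-neighbourhood of `f₁` in the space `L_1`. -/
def ballOne (f₁ : ℝ → ℝ) (ε : ℝ) : Set (ℝ → ℝ) :=
  {f | IsSpectralDensity f ∧ 1 / (2 * Real.pi) * ∫ l, |f l - f₁ l| ≤ ε}

/-- The `ε`-neighbourhood of `g₁` in the space `L_2`. -/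
def ballTwo (g₁ : ℝ → ℝ) (ε : ℝ) : Set (ℝ → ℝ) :=
  {g | IsSpectralDensity g ∧ MemLp (fun l => g l - g₁ l) 2 ∧
    1 / (2 * Real.pi) * ∫ l, |g l - g₁ l| ^ 2 ≤ ε}

/-! ### Linear estimates, mean-square error, optimality -/

/-- The measure with density `f + g`. -/
def specMeasure (f g : ℝ → ℝ) : Measure ℝ :=
  volume.withDensity fun l => ENNReal.ofReal (f l + g l)

/-- The linear span of the functions `e^{itλ}`, `t ∈ O`. -/
def expSpan (O : Set ℝ) : Submodule ℂ (ℝ → ℂ) :=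
  Submodule.span ℂ ((fun t l : ℝ => Complex.exp (Complex.I * t * l)) '' O)

/-- `h` belongs to the closed subspace `L_2^s(f+g)` of `L_2(f+g)` generated by `e^{itλ}`, `t ∈ O`. -/
def MemL2s (O : Set ℝ) (f g : ℝ → ℝ) (h : ℝ → ℂ) : Prop :=
  MemLp h 2 (specMeasure f g) ∧
    ∀ ε : ℝ≥0∞, ε ≠ 0 → ∃ p ∈ expSpan O, eLpNorm (h - p) 2 (specMeasure f g) ≤ ε

/-- The mean-square error
`Δ(h; f, g) = (1/2π) ∫ |A - h|² f dλ + (1/2π) ∫ |h|² g dλ`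
of the estimate with spectral characteristic `h`. -/
def mse (A h : ℝ → ℂ) (f g : ℝ → ℝ) : ℝ≥0∞ :=
  ENNReal.ofReal (1 / (2 * Real.pi)) *
    ∫⁻ l, (‖A l - h l‖ₑ ^ 2 * ENNReal.ofReal (f l) + ‖h l‖ₑ ^ 2 * ENNReal.ofReal (g l))

/-- `h = h(f, g)` is the spectral characteristic of the mean-square optimal linear estimate. -/
def IsOptimal (O : Set ℝ) (A : ℝ → ℂ) (f g : ℝ → ℝ) (h : ℝ → ℂ) : Prop :=
  MemL2s O f g h ∧ ∀ k, MemL2s O f g k → mse A h f g ≤ mse A k f g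

/-- The mean-square error `Δ(f, g)` of the optimal linear estimate, i.e. the least value of
`Δ(h; f, g)` over `h ∈ L_2^s(f+g)`. -/
def optError (O : Set ℝ) (A : ℝ → ℂ) (f g : ℝ → ℝ) : ℝ≥0∞ :=
  ⨅ (h : ℝ → ℂ) (_ : MemL2s O f g h), mse A h f g

/-- `(f₀, g₀) ∈ D` is least favorable: `Δ(f₀, g₀) = max_{(f,g) ∈ D} Δ(f, g)`. -/
def IsLeastFavorable (O : Set ℝ) (A : ℝ → ℂ) (Df Dg : Set (ℝ → ℝ)) (f₀ g₀ : ℝ → ℝ) : Prop :=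
  f₀ ∈ Df ∧ g₀ ∈ Dg ∧ ∀ f ∈ Df, ∀ g ∈ Dg, optError O A f g ≤ optError O A f₀ g₀

/-- The class `H_D`, the intersection of the spaces `L_2^s(f+g)` over `(f, g) ∈ D`. -/
def classH (O : Set ℝ) (Df Dg : Set (ℝ → ℝ)) : Set (ℝ → ℂ) :=
  {h | ∀ f ∈ Df, ∀ g ∈ Dg, MemL2s O f g h}

/-- `h₀` is a minimax-robust spectral characteristic: `h₀ ∈ H_D`, the maximum of `Δ(h₀; f, g)` over
`D` is attained, and it is the least value of `sup_D Δ(h; f, g)` over `h ∈ H_D`. -/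
def IsMinimaxRobust (O : Set ℝ) (A : ℝ → ℂ) (Df Dg : Set (ℝ → ℝ)) (h₀ : ℝ → ℂ) : Prop :=
  h₀ ∈ classH O Df Dg ∧
    ∃ v, IsGreatest {e | ∃ f ∈ Df, ∃ g ∈ Dg, e = mse A h₀ f g} v ∧
      ∀ h ∈ classH O Df Dg, v ≤ ⨆ f ∈ Df, ⨆ g ∈ Dg, mse A h f g

/-! ### The operators `B`, `R`, `Q` -/

/-- Complex `L_2` on the line. -/
abbrev L2R : Type := Lp ℂ 2 (volume : Measure ℝ)

/-- `L_2(T)`, as the elements of `L_2(ℝ)` that vanish off `T`. -/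
def L2On (T : Set ℝ) : Set L2R := {x | ∀ᵐ t, t ∉ T → x t = 0}

/-- The Fourier (Plancherel) transform `x̂(λ) = ∫ x(t) e^{itλ} dt` of `x ∈ L_2(ℝ)`; Mathlib's
`𝓕 x` has the kernel `e^{-2πi t u}`. -/
def hatL2 (x : L2R) (l : ℝ) : ℂ := (𝓕 x : L2R) (-(l / (2 * Real.pi)))

/-- The inner product `⟨x, y⟩ = ∫_T x(t) conj(y(t)) dt` of `L_2(T)`. -/
def innerT (T : Set ℝ) (x y : ℝ → ℂ) : ℂ := ∫ t in T, x t * conj (y t)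

/-- `y = R x`, where `R` is the (bounded) operator of `L_2(T)` with the kernel
`(1/2π) ∫ e^{-iλ(u+t)} f(λ)/(f(λ)+g(λ)) dλ`.  As `f/(f+g)` is bounded but not integrable, the
kernel means that `R x` is the restriction to `T` of the inverse Fourier transform of
`x̂(-λ) f(λ)/(f(λ)+g(λ))`; this is expressed by pairing with all of `L_2(T)`. -/
def IsR (T : Set ℝ) (f g : ℝ → ℝ) (x y : L2R) : Prop :=
  x ∈ L2On T ∧ y ∈ L2On T ∧ ∀ ψ ∈ L2On T,
    1 / (2 * Real.pi) * ∫ l, ((f l / (f l + g l) : ℝ) : ℂ) * hatL2 x (-l) * conj (hatL2 ψ l) =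
      innerT T y ψ

/-- `y = B x`, where `B` is the operator of `L_2(T)` with the kernel
`(1/2π) ∫ e^{iλ(u-t)} / (f(λ)+g(λ)) dλ`.  As `f + g` is integrable, `1/(f+g)` is not, and the kernel
is a generalized function: `B x` is the restriction to `T` of the inverse Fourier transform of
`x̂/(f+g)`, expressed by pairing with the elements of `L_2(T)` whose Fourier transform is
integrable.  The domain consists of the `x ∈ L_2(T)` for which the quadratic form
`(1/2π) ∫ |x̂|²/(f+g)` and all these pairings converge.  An element of the domain has an integrable
Fourier transform itself, so that `B` is injective when `f + g > 0` almost everywhere. -/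
def IsB (T : Set ℝ) (f g : ℝ → ℝ) (x y : L2R) : Prop :=
  x ∈ L2On T ∧ y ∈ L2On T ∧
    Integrable (fun l => ‖hatL2 x l‖ ^ 2 / (f l + g l)) ∧
    ∀ ψ ∈ L2On T, Integrable (hatL2 ψ) →
      Integrable (fun l => hatL2 x l * conj (hatL2 ψ l) / ((f l + g l : ℝ) : ℂ)) ∧
      1 / (2 * Real.pi) * ∫ l, hatL2 x l * conj (hatL2 ψ l) / ((f l + g l : ℝ) : ℂ) =
        innerT T y ψ

/-- The operator `Q` with the kernel `(1/2π) ∫ e^{-iλ(u-t)} f(λ)g(λ)/(f(λ)+g(λ)) dλ`. -/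
def opQ (T : Set ℝ) (f g : ℝ → ℝ) (x : ℝ → ℂ) (t : ℝ) : ℂ :=
  1 / (2 * Real.pi) * ∫ u in T, x u *
    ∫ l : ℝ, Complex.exp (-(Complex.I * l * (u - t))) * ((f l * g l / (f l + g l) : ℝ) : ℂ)

/-- The value `⟨r, c⟩ + ⟨Q a, a⟩`, which for `r = R a` and `c = B⁻¹ R a` is the quantity
`⟨R a, B⁻¹ R a⟩ + ⟨Q a, a⟩`. -/
def errorForm (T : Set ℝ) (f g : ℝ → ℝ) (a r c : L2R) : ℝ :=
  (innerT T r c + innerT T (opQ T f g a) a).re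

/-- The pair `(f₀, g₀)`, with `r₀ = R⁰ a` and `c₀ = (B⁰)⁻¹ R⁰ a`, solves the extremal problem: it
maximizes `⟨R a, B⁻¹ R a⟩ + ⟨Q a, a⟩` among the pairs of `D = Df × Dg` that satisfy the minimality
condition and for which `B⁻¹ R a` exists. -/
def SolvesExtremal (T : Set ℝ) (Df Dg : Set (ℝ → ℝ)) (a : L2R) (f₀ g₀ : ℝ → ℝ) (r₀ c₀ : L2R) :
    Prop :=
  ∀ f ∈ Df, ∀ g ∈ Dg, Minimality f g → ∀ r c, IsR T f g a r → IsB T f g c r →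
    errorForm T f g a r c ≤ errorForm T f₀ g₀ a r₀ c₀

/-! ### The spectral characteristic and the weights -/

/-- `h = A f/(f+g) - C/(f+g)`. -/
def specChar (A C : ℝ → ℂ) (f g : ℝ → ℝ) (l : ℝ) : ℂ :=
  A l * ((f l / (f l + g l) : ℝ) : ℂ) - C l / ((f l + g l : ℝ) : ℂ)

/-- `h_f = |A g + C|² / (f+g)²`. -/
def weightF (A C : ℝ → ℂ) (f g : ℝ → ℝ) (l : ℝ) : ℝ :=
  ‖A l * (g l : ℂ) + C l‖ ^ 2 / (f l + g l) ^ 2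

/-- `h_g = |A f - C|² / (f+g)²`. -/
def weightG (A C : ℝ → ℂ) (f g : ℝ → ℝ) (l : ℝ) : ℝ :=
  ‖A l * (f l : ℂ) - C l‖ ^ 2 / (f l + g l) ^ 2

/-- Essentially bounded. -/
def EssBounded (w : ℝ → ℝ) : Prop := ∃ M : ℝ, ∀ᵐ l, |w l| ≤ M

end MissingFilter

end

namespace MissingFilter

/-! ### The Fourier transform of square integrable functions -/

/-! The triple `(h⁰; f₀, g₀)` is a saddle point of `Δ`. For fixed `h` the error `Δ(h; f, g)` is
linear in `(f, g)`, with weights `|A - h|²` and `|h|²`; at `h = h⁰` these are `h_f` and `h_g`. The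
equations for the weights are Lagrange conditions: they make `(f₀, g₀)` a maximizer of this linear
functional over the two balls (`integral_mul_le_of_mem_ballOne`, `integral_mul_le_of_mem_ballTwo`).

In the other variable, `A f₀ - h⁰ (f₀ + g₀) = C⁰` is the Fourier transform of a function supported
in `T`, hence orthogonal to the exponentials of the observed times; by the orthogonality principle
`h⁰` minimizes `Δ(·; f₀, g₀)` (`specChar_isOptimal`).

The delicate point is `h⁰ ∈ L_2^s(f+g)` for every pair of `D`, not only for `(f₀, g₀)`. The equation
`B c = R a` says that `h⁰` is orthogonal, for Lebesgue measure, to the integrable transforms of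
elements of `L_2(T)`. As `h⁰` is bounded, mollification in frequency extends this to all integrable
`Φ` whose Fourier coefficients vanish off `T` (`integral_mul_conj_eq_zero_of_hatL2`). Every `φ ∈
L_2(f+g)` orthogonal to the exponentials yields such a `Φ = (f+g) φ`, so `h⁰` lies in the double
orthogonal complement of the exponentials, which is `L_2^s(f+g)` (`MemL2s.of_bounded`). -/

theorem integral_fourier_mul_eq {x y : ℝ → ℂ} (hx : Integrable x) (hy : Integrable y) :
    ∫ t, 𝓕 x t * y t = ∫ t, x t * 𝓕 y t := by
  have h := VectorFourier.integral_fourierIntegral_smul_eq_flip (L := innerₗ ℝ)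
    (μ := (volume : Measure ℝ)) (ν := (volume : Measure ℝ))
    Real.continuous_fourierChar continuous_inner hx hy
  rw [flip_innerₗ] at h
  exact h

theorem continuous_fourier {x : ℝ → ℂ} (hx : Integrable x) : Continuous (𝓕 x) :=
  VectorFourier.fourierIntegral_continuous Real.continuous_fourierChar
    (by exact continuous_inner) hx

theorem continuous_fourierInv {x : ℝ → ℂ} (hx : Integrable x) : Continuous (𝓕⁻ x) := by
  have : 𝓕⁻ x = fun t => 𝓕 x (-t) := funext fun t => Real.fourierInv_eq_fourier_neg x t
  rw [this]
  exact (continuous_fourier hx).comp continuous_neg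

/-- The Plancherel transform is known through its action on tempered distributions. Pairing with
compactly supported smooth functions and moving the transform onto the test function identifies it
with the integral. -/
theorem fourier_toLp_ae_eq {x : ℝ → ℂ} (h2 : MemLp x 2) (h1 : Integrable x) :
    ∀ᵐ t, (𝓕 (h2.toLp x) : L2R) t = 𝓕 x t := by
  apply ae_eq_of_integral_contDiff_smul_eq
  · exact (Lp.memLp _).locallyIntegrable (by norm_num)
  · exact (continuous_fourier h1).locallyIntegrable
  intro g hg hgc
  have hg₁ : HasCompactSupport (Complex.ofRealCLM ∘ g) := hgc.comp_left rfl
  have hg₂ : ContDiff ℝ (⊤ : ℕ∞) (Complex.ofRealCLM ∘ g) := by fun_prop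
  set G := hg₁.toSchwartzMap hg₂ with hG
  have hGg : ∀ t, G t = (g t : ℂ) := fun t => rfl
  have h := DFunLike.congr_fun (Lp.fourier_toTemperedDistribution_eq (h2.toLp x)) G
  rw [TemperedDistribution.fourier_apply, Lp.toTemperedDistribution_apply,
    Lp.toTemperedDistribution_apply] at h
  calc ∫ t, g t • (𝓕 (h2.toLp x) : L2R) t = ∫ t, G t • (𝓕 (h2.toLp x) : L2R) t := by
        simp [hGg]
    _ = ∫ t, (𝓕 G) t • (h2.toLp x) t := h.symm
    _ = ∫ t, 𝓕 (G : ℝ → ℂ) t * x t := by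
        apply integral_congr_ae
        filter_upwards [h2.coeFn_toLp] with t ht
        rw [ht, SchwartzMap.fourier_coe, smul_eq_mul]
    _ = ∫ t, G t * 𝓕 x t := integral_fourier_mul_eq G.integrable h1
    _ = ∫ t, g t • 𝓕 x t := by simp [hGg]

theorem fourierInv_toLp_ae_eq {x : ℝ → ℂ} (h2 : MemLp x 2) (h1 : Integrable x) :
    ∀ᵐ t, (𝓕⁻ (h2.toLp x) : L2R) t = 𝓕⁻ x t := by
  apply ae_eq_of_integral_contDiff_smul_eq
  · exact (Lp.memLp _).locallyIntegrable (by norm_num)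
  · exact (continuous_fourierInv h1).locallyIntegrable
  intro g hg hgc
  have hg₁ : HasCompactSupport (Complex.ofRealCLM ∘ g) := hgc.comp_left rfl
  have hg₂ : ContDiff ℝ (⊤ : ℕ∞) (Complex.ofRealCLM ∘ g) := by fun_prop
  set G := hg₁.toSchwartzMap hg₂ with hG
  have hGg : ∀ t, G t = (g t : ℂ) := fun t => rfl
  have h := DFunLike.congr_fun (Lp.fourierInv_toTemperedDistribution_eq (h2.toLp x)) G
  rw [TemperedDistribution.fourierInv_apply, Lp.toTemperedDistribution_apply,
    Lp.toTemperedDistribution_apply] at h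
  calc ∫ t, g t • (𝓕⁻ (h2.toLp x) : L2R) t = ∫ t, G t • (𝓕⁻ (h2.toLp x) : L2R) t := by
        simp [hGg]
    _ = ∫ t, (𝓕⁻ G) t • (h2.toLp x) t := h.symm
    _ = ∫ t, 𝓕 (fun t => G (-t)) t * x t := by
        apply integral_congr_ae
        filter_upwards [h2.coeFn_toLp] with t ht
        rw [ht, SchwartzMap.fourierInv_coe, smul_eq_mul, Real.fourierInv_eq_fourier_comp_neg]
    _ = ∫ t, G (-t) * 𝓕 x t := integral_fourier_mul_eq G.integrable.comp_neg h1
    _ = ∫ t, G t * 𝓕 x (-t) := by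
        rw [← integral_neg_eq_self]
        simp
    _ = ∫ t, g t • 𝓕⁻ x t := by
        simp [hGg, Real.fourierInv_eq_fourier_neg]

/-! ### Spectral synthesis for bounded functions -/

/-- If a bounded function is orthogonal to the integrable Fourier transforms of all square
integrable functions vanishing on `O`, then its mollifications are orthogonal to all integrable
functions whose inverse Fourier transform vanishes on `O`. -/
theorem integral_bump_mul_conj_eq_zero {O : Set ℝ} {H : ℝ → ℂ} {M : ℝ}
    (hHm : AEStronglyMeasurable H) (hHb : ∀ᵐ u, ‖H u‖ ≤ M)
    (hH : ∀ ψ : L2R, (∀ᵐ t, t ∈ O → ψ t = 0) → Integrable (𝓕 ψ : L2R) →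
      ∫ u, H u * conj ((𝓕 ψ : L2R) u) = 0)
    {Φ : ℝ → ℂ} (hΦ : Integrable Φ) (hΦO : ∀ t ∈ O, 𝓕⁻ Φ t = 0) (φ : ContDiffBump (0 : ℝ)) :
    ∫ m, (∫ u, φ.normed volume (m - u) • H u) * conj (Φ m) = 0 := by
  set k : ℝ → ℂ := fun t => (φ.normed volume t : ℂ) with hk
  have hki : Integrable k := φ.integrable_normed.ofReal
  obtain ⟨B, hB⟩ : ∃ B : ℝ, ∀ t, ‖k t‖ ≤ B := by
    obtain ⟨B, hB⟩ := (φ.continuous_normed (μ := volume)).bounded_above_of_compact_support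
      φ.hasCompactSupport_normed
    exact ⟨B, fun t => by rw [hk]; simpa using hB t⟩
  set L := ContinuousLinearMap.mul ℂ ℂ with hL
  -- `Φ` is only integrable and need not be the transform of an `L_2` function. Smoothing it by the
  -- bump makes it bounded, so `G` lies in `L_1 ∩ L_2` and `ψ = 𝓕⁻ G` is admissible in `hH`. As the
  -- bump is even, Fubini moves the smoothing from `Φ` to `H`.
  set G : ℝ → ℂ := convolution Φ k L volume with hG
  have hGdef : ∀ u, G u = ∫ m, Φ m * k (u - m) := fun u => rfl
  have hGi : Integrable G := hΦ.integrable_convolution L hki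
  have hGb : ∀ u, ‖G u‖ ≤ ∫ m, ‖Φ m‖ * B := fun u => by
    rw [hGdef]
    refine norm_integral_le_of_norm_le (hΦ.norm.mul_const B) (.of_forall fun m => ?_)
    rw [norm_mul]
    exact mul_le_mul_of_nonneg_left (hB _) (norm_nonneg _)
  have hG2 : MemLp G 2 := by
    rw [memLp_two_iff_integrable_sq_norm hGi.1]
    simp_rw [sq]
    exact hGi.norm.bdd_mul hGi.1.norm (.of_forall fun u => by rw [norm_norm]; exact hGb u)
  have hψ : (𝓕 (𝓕⁻ (hG2.toLp G) : L2R) : L2R) = hG2.toLp G :=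
    FourierTransform.fourier_fourierInv_eq _
  have h0 := hH (𝓕⁻ (hG2.toLp G)) ?_ ?_
  · rw [hψ] at h0
    have h1 : ∫ u, H u * conj (G u) = 0 := by
      rw [← h0]
      refine integral_congr_ae ?_
      filter_upwards [hG2.coeFn_toLp] with u hu
      rw [hu]
    have hprod : Integrable (Function.uncurry fun u m => H u * conj (Φ m * k (u - m)))
        (volume.prod volume) := by
      have h := (hΦ.convolution_integrand L hki)
      have h' : Integrable (fun p : ℝ × ℝ => conj (Φ p.2 * k (p.1 - p.2)))
          (volume.prod volume) := by
        refine h.congr' (Complex.continuous_conj.comp_aestronglyMeasurable h.1) ?_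
        exact .of_forall fun p => by simp [L]
      refine h'.bdd_mul (c := M) hHm.comp_fst ?_
      exact Measure.quasiMeasurePreserving_fst.ae hHb
    rw [← h1]
    calc ∫ m, (∫ u, φ.normed volume (m - u) • H u) * conj (Φ m)
        = ∫ m, ∫ u, H u * conj (Φ m * k (u - m)) := by
          refine integral_congr_ae (.of_forall fun m => ?_)
          simp only
          rw [← integral_mul_const]
          refine integral_congr_ae (.of_forall fun u => ?_)
          simp only [hk, map_mul, Complex.conj_ofReal, Complex.real_smul]
          rw [← neg_sub u m, φ.normed_neg]
          ring
      _ = ∫ u, ∫ m, H u * conj (Φ m * k (u - m)) := (integral_integral_swap hprod).symm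
      _ = ∫ u, H u * conj (G u) := by
          refine integral_congr_ae (.of_forall fun u => ?_)
          simp only
          rw [integral_const_mul, hGdef, integral_conj]
  -- Convolution in frequency is multiplication in time, so the zeros of `𝓕⁻ Φ` on `O` survive for
  -- an arbitrary set `O`.
  · filter_upwards [fourierInv_toLp_ae_eq hG2 hGi] with t ht htO
    rw [ht, Real.fourierInv_eq_fourier_neg, hG, Real.fourier_mul_convolution_eq hΦ hki,
      ← Real.fourierInv_eq_fourier_neg, hΦO t htO, zero_mul]
  · rw [hψ]
    exact hGi.congr hG2.coeFn_toLp.symm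

/-- A bounded function orthogonal to the integrable Fourier transforms of all square integrable
functions vanishing on `O` is orthogonal to all integrable functions whose inverse Fourier transform
vanishes on `O`. -/
theorem integral_mul_conj_eq_zero {O : Set ℝ} {H : ℝ → ℂ} {M : ℝ}
    (hHm : AEStronglyMeasurable H) (hHb : ∀ᵐ u, ‖H u‖ ≤ M)
    (hH : ∀ ψ : L2R, (∀ᵐ t, t ∈ O → ψ t = 0) → Integrable (𝓕 ψ : L2R) →
      ∫ u, H u * conj ((𝓕 ψ : L2R) u) = 0)
    {Φ : ℝ → ℂ} (hΦ : Integrable Φ) (hΦO : ∀ t ∈ O, 𝓕⁻ Φ t = 0) :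
    ∫ u, H u * conj (Φ u) = 0 := by
  -- `H` is merely bounded, so its mollifications converge only almost everywhere, by Lebesgue
  -- differentiation. This requires a bounded ratio `rOut / rIn`, here equal to 2.
  obtain ⟨φ, hφ⟩ : ∃ φ : ℕ → ContDiffBump (0 : ℝ),
      ∀ n, (φ n).rIn = 1 / (n + 1) ∧ (φ n).rOut = 2 / (n + 1) :=
    ⟨fun n => ⟨1 / (n + 1), 2 / (n + 1), by positivity, by gcongr; norm_num⟩,
      fun n => ⟨rfl, rfl⟩⟩
  have hφ0 : Filter.Tendsto (fun n => (φ n).rOut) Filter.atTop (nhds 0) := by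
    simp_rw [(hφ _).2]
    have := (tendsto_one_div_add_atTop_nhds_zero_nat (𝕜 := ℝ)).const_mul 2
    simpa [div_eq_mul_inv] using this
  have hHloc : LocallyIntegrable H := by
    refine (locallyIntegrable_const M).mono hHm ?_
    filter_upwards [hHb] with u hu
    exact hu.trans (le_abs_self M)
  have hlim := ContDiffBump.ae_convolution_tendsto_right_of_locallyIntegrable (K := 2)
    hφ0 (Filter.Eventually.of_forall fun n => by rw [(hφ n).1, (hφ n).2]; ring_nf; rfl) hHloc
  simp_rw [convolution_lsmul_swap] at hlim
  have hzero : ∀ n, ∫ m, (∫ u, (φ n).normed volume (m - u) • H u) * conj (Φ m) = 0 := fun n =>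
    integral_bump_mul_conj_eq_zero hHm hHb hH hΦ hΦO (φ n)
  have hconv : Filter.Tendsto
      (fun n => ∫ m, (∫ u, (φ n).normed volume (m - u) • H u) * conj (Φ m)) Filter.atTop
      (nhds (∫ m, H m * conj (Φ m))) := by
    refine tendsto_integral_of_dominated_convergence (fun m => M * ‖Φ m‖) (fun n => ?_)
      (hΦ.norm.const_mul M) (fun n => ?_) ?_
    · refine AEStronglyMeasurable.mul ?_ (Complex.continuous_conj.comp_aestronglyMeasurable hΦ.1)
      have h := (φ n).hasCompactSupport_normed (μ := volume)
        |>.continuous_convolution_left (ContinuousLinearMap.lsmul ℝ ℝ)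
          (φ n).continuous_normed hHloc
      have h' : (fun m => ∫ u, (φ n).normed volume (m - u) • H u) = convolution
          ((φ n).normed volume) H (ContinuousLinearMap.lsmul ℝ ℝ) volume :=
        funext fun m => convolution_lsmul_swap.symm
      rw [h']
      exact h.aestronglyMeasurable
    · refine Filter.Eventually.of_forall fun m => ?_
      rw [norm_mul, RCLike.norm_conj]
      refine mul_le_mul_of_nonneg_right ?_ (norm_nonneg _)
      calc ‖∫ u, (φ n).normed volume (m - u) • H u‖
          ≤ ∫ u, (φ n).normed volume (m - u) * M := by
            refine norm_integral_le_of_norm_le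
              (((φ n).integrable_normed.comp_sub_left m).mul_const M) ?_
            filter_upwards [hHb] with u hu
            rw [norm_smul, Real.norm_of_nonneg ((φ n).nonneg_normed _)]
            exact mul_le_mul_of_nonneg_left hu ((φ n).nonneg_normed _)
        _ = M := by
            rw [integral_mul_const, integral_sub_left_eq_self, (φ n).integral_normed, one_mul]
    · filter_upwards [hlim] with m hm
      exact hm.mul_const _
  simp_rw [hzero] at hconv
  exact (tendsto_nhds_unique hconv tendsto_const_nhds)

/-! ### The space `L_2^s(f+g)` by duality -/

section specMeasure

variable {f g : ℝ → ℝ}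

theorem isFiniteMeasure_specMeasure (hf : IsSpectralDensity f) (hg : IsSpectralDensity g) :
    IsFiniteMeasure (specMeasure f g) :=
  isFiniteMeasure_withDensity_ofReal (hf.2.add hg.2).2

theorem specMeasure_absolutelyContinuous : specMeasure f g ≪ volume :=
  withDensity_absolutelyContinuous _ _

theorem aemeasurable_specDensity (hf : IsSpectralDensity f) (hg : IsSpectralDensity g) :
    AEMeasurable fun l => ENNReal.ofReal (f l + g l) :=
  (hf.2.add hg.2).1.aemeasurable.ennreal_ofReal

theorem integral_specMeasure (hf : IsSpectralDensity f) (hg : IsSpectralDensity g) (φ : ℝ → ℂ) :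
    ∫ l, φ l ∂specMeasure f g = ∫ l, ((f l + g l : ℝ) : ℂ) * φ l := by
  rw [specMeasure, integral_withDensity_eq_integral_toReal_smul₀
    (aemeasurable_specDensity hf hg) (.of_forall fun l => ENNReal.ofReal_lt_top)]
  refine integral_congr_ae (.of_forall fun l => ?_)
  simp only
  rw [ENNReal.toReal_ofReal (add_nonneg (hf.1 l) (hg.1 l)), Complex.real_smul]

theorem integrable_specMeasure_iff {E : Type*} [NormedAddCommGroup E] [NormedSpace ℝ E]
    (hf : IsSpectralDensity f) (hg : IsSpectralDensity g) {φ : ℝ → E} :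
    Integrable φ (specMeasure f g) ↔ Integrable fun l => (f l + g l) • φ l := by
  rw [specMeasure, integrable_withDensity_iff_integrable_smul₀'
    (aemeasurable_specDensity hf hg) (.of_forall fun l => ENNReal.ofReal_lt_top)]
  refine integrable_congr (.of_forall fun l => ?_)
  simp only
  rw [ENNReal.toReal_ofReal (add_nonneg (hf.1 l) (hg.1 l))]

end specMeasure

theorem continuous_exp_mul (t : ℝ) : Continuous fun l : ℝ => Complex.exp (Complex.I * t * l) := by
  fun_prop

theorem memLp_exp_mul {μ : Measure ℝ} [IsFiniteMeasure μ] (t : ℝ) :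
    MemLp (fun l : ℝ => Complex.exp (Complex.I * t * l)) 2 μ := by
  refine MemLp.of_bound (continuous_exp_mul t).aestronglyMeasurable 1 (.of_forall fun l => ?_)
  have : Complex.I * t * l = ((t * l : ℝ) : ℂ) * Complex.I := by push_cast; ring
  rw [this, Complex.norm_exp_ofReal_mul_I]

theorem memLp_of_mem_expSpan {μ : Measure ℝ} [IsFiniteMeasure μ] {O : Set ℝ} {p : ℝ → ℂ}
    (hp : p ∈ expSpan O) : MemLp p 2 μ := by
  induction hp using Submodule.span_induction with
  | mem x hx => obtain ⟨t, -, rfl⟩ := hx; exact memLp_exp_mul t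
  | zero => exact MemLp.zero
  | add x y _ _ hx hy => exact hx.add hy
  | smul c x _ hx => exact hx.const_smul c

theorem inner_toLp_eq_integral {μ : Measure ℝ} {x y : ℝ → ℂ} (hx : MemLp x 2 μ)
    (hy : MemLp y 2 μ) : inner ℂ (hx.toLp x) (hy.toLp y) = ∫ l, y l * conj (x l) ∂μ := by
  rw [L2.inner_def]
  refine integral_congr_ae ?_
  filter_upwards [hx.coeFn_toLp, hy.coeFn_toLp] with l h1 h2
  rw [h1, h2]
  rfl

/-- In a Hilbert space the double orthogonal complement of a subspace is its closure. The rest of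
the argument passes between classes in `Lp` and actual trigonometric polynomials. -/
theorem MemL2s.of_orthogonal {O : Set ℝ} {f g : ℝ → ℝ} (hf : IsSpectralDensity f)
    (hg : IsSpectralDensity g) {h : ℝ → ℂ} (hh : MemLp h 2 (specMeasure f g))
    (horth : ∀ φ : ℝ → ℂ, MemLp φ 2 (specMeasure f g) →
      (∀ t ∈ O, ∫ l : ℝ, Complex.exp (Complex.I * t * l) * conj (φ l) ∂specMeasure f g = 0) →
      ∫ l, h l * conj (φ l) ∂specMeasure f g = 0) :
    MemL2s O f g h := by
  have := isFiniteMeasure_specMeasure hf hg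
  set μ := specMeasure f g
  refine ⟨hh, fun ε hε => ?_⟩
  set W : Submodule ℂ (Lp ℂ 2 μ) :=
    Submodule.span ℂ ((fun t => (memLp_exp_mul (μ := μ) t).toLp _) '' O) with hW
  have hrep : ∀ y ∈ W, ∃ p ∈ expSpan O, y =ᵐ[μ] p := by
    intro y hy
    induction hy using Submodule.span_induction with
    | mem x hx =>
      obtain ⟨t, ht, rfl⟩ := hx
      exact ⟨_, Submodule.subset_span ⟨t, ht, rfl⟩, MemLp.coeFn_toLp _⟩
    | zero => exact ⟨0, Submodule.zero_mem _, Lp.coeFn_zero _ _ _⟩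
    | add x y _ _ hx hy =>
      obtain ⟨p, hp, hxp⟩ := hx
      obtain ⟨q, hq, hyq⟩ := hy
      exact ⟨p + q, Submodule.add_mem _ hp hq, (Lp.coeFn_add x y).trans (hxp.add hyq)⟩
    | smul c x _ hx =>
      obtain ⟨p, hp, hxp⟩ := hx
      exact ⟨c • p, Submodule.smul_mem _ c hp, (Lp.coeFn_smul c x).trans (hxp.const_smul c)⟩
  have hmem : hh.toLp h ∈ W.topologicalClosure := by
    rw [← Submodule.orthogonal_orthogonal_eq_closure, Submodule.mem_orthogonal]
    intro φ hφ
    rw [Submodule.mem_orthogonal] at hφ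
    have hφ' := Lp.memLp φ
    have key := horth φ hφ' fun t ht => by
      have h1 := hφ _ (Submodule.subset_span ⟨t, ht, rfl⟩)
      rw [← inner_conj_symm, map_eq_zero] at h1
      rw [← inner_toLp_eq_integral hφ' (memLp_exp_mul t), Lp.toLp_coeFn]
      exact h1
    rw [← inner_toLp_eq_integral hφ' hh, Lp.toLp_coeFn] at key
    exact key
  have hcl : hh.toLp h ∈ closure (W : Set (Lp ℂ 2 μ)) := hmem
  obtain ⟨y, hy, hlt⟩ := EMetric.mem_closure_iff.1 hcl ε (pos_iff_ne_zero.2 hε)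
  obtain ⟨p, hp, hyp⟩ := hrep y hy
  refine ⟨p, hp, le_of_eq_of_le ?_ hlt.le⟩
  rw [Lp.edist_def]
  exact eLpNorm_congr_ae (hh.coeFn_toLp.sub hyp).symm

theorem MemL2s.integral_mul_conj_eq_zero {O : Set ℝ} {f g : ℝ → ℝ} (hf : IsSpectralDensity f)
    (hg : IsSpectralDensity g) {h φ : ℝ → ℂ} (hh : MemL2s O f g h)
    (hφ : MemLp φ 2 (specMeasure f g))
    (horth : ∀ t ∈ O,
      ∫ l : ℝ, Complex.exp (Complex.I * t * l) * conj (φ l) ∂specMeasure f g = 0) :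
    ∫ l, h l * conj (φ l) ∂specMeasure f g = 0 := by
  have := isFiniteMeasure_specMeasure hf hg
  set μ := specMeasure f g
  have hspan : ∀ p ∈ expSpan O, ∀ hp : MemLp p 2 μ,
      inner ℂ (hφ.toLp φ) (hp.toLp p) = 0 := by
    intro p hp
    induction hp using Submodule.span_induction with
    | mem x hx =>
      obtain ⟨t, ht, rfl⟩ := hx
      intro hp
      rw [inner_toLp_eq_integral hφ hp]
      exact horth t ht
    | zero => intro hp; rw [MemLp.toLp_zero, inner_zero_right]
    | add x y hx' hy' hx hy =>
      intro hp
      rw [MemLp.toLp_add (memLp_of_mem_expSpan hx') (memLp_of_mem_expSpan hy'), inner_add_right,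
        hx, hy, add_zero]
    | smul c x hx' hx =>
      intro hp
      rw [MemLp.toLp_const_smul c (memLp_of_mem_expSpan hx'), inner_smul_right, hx, mul_zero]
  rw [← inner_toLp_eq_integral hφ hh.1, ← norm_eq_zero]
  refine le_antisymm (le_of_forall_pos_le_add fun δ hδ => ?_) (norm_nonneg _)
  -- Chosen for Cauchy–Schwarz; the added 1 covers `φ = 0`.
  set ε := δ / (‖hφ.toLp φ‖ + 1) with hε
  have hεpos : 0 < ε := by positivity
  obtain ⟨p, hp, hle⟩ := hh.2 (ENNReal.ofReal ε) (by simpa using hεpos)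
  have hpm : MemLp p 2 μ := memLp_of_mem_expSpan hp
  have h1 : inner ℂ (hφ.toLp φ) (hh.1.toLp h) =
      inner ℂ (hφ.toLp φ) ((hh.1.sub hpm).toLp (h - p)) := by
    rw [MemLp.toLp_sub hh.1 hpm, inner_sub_right, hspan p hp hpm, sub_zero]
  have h2 : ‖(hh.1.sub hpm).toLp (h - p)‖ ≤ ε := by
    rw [Lp.norm_toLp]
    exact ENNReal.toReal_le_of_le_ofReal hεpos.le hle
  rw [h1, zero_add]
  calc _ ≤ ‖hφ.toLp φ‖ * ‖(hh.1.sub hpm).toLp (h - p)‖ := norm_inner_le_norm _ _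
    _ ≤ (‖hφ.toLp φ‖ + 1) * ε := by gcongr; linarith
    _ = δ := by rw [hε]; field_simp

/-- A bounded function orthogonal to all integrable functions with vanishing Fourier coefficients on
`O` belongs to all the spaces `L_2^s(f+g)`. -/
theorem MemL2s.of_bounded {O : Set ℝ} {f g : ℝ → ℝ} (hf : IsSpectralDensity f)
    (hg : IsSpectralDensity g) {h : ℝ → ℂ} {M : ℝ} (hm : AEStronglyMeasurable h)
    (hb : ∀ᵐ l, ‖h l‖ ≤ M)
    (horth : ∀ Φ : ℝ → ℂ, Integrable Φ →
      (∀ t ∈ O, ∫ l : ℝ, Complex.exp (Complex.I * t * l) * conj (Φ l) = 0) →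
      ∫ l, h l * conj (Φ l) = 0) :
    MemL2s O f g h := by
  have := isFiniteMeasure_specMeasure hf hg
  have hac := specMeasure_absolutelyContinuous (f := f) (g := g)
  -- The density is absorbed into `φ`, which removes the measure from the orthogonality relation.
  -- Since `specMeasure f g` is finite, `φ` is integrable for it, so `(f+g) φ` is Lebesgue
  -- integrable.
  have hswap : ∀ y φ : ℝ → ℂ, ∫ l, y l * conj (φ l) ∂specMeasure f g =
      ∫ l, y l * conj ((f l + g l) • φ l) := fun y φ => by
    rw [integral_specMeasure hf hg]
    refine integral_congr_ae (.of_forall fun l => ?_)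
    simp only [Complex.real_smul, map_mul, Complex.conj_ofReal]
    ring
  refine .of_orthogonal hf hg (MemLp.of_bound (hm.mono_ac hac) M (hac hb)) fun φ hφ hφO => ?_
  rw [hswap]
  refine horth _ ((integrable_specMeasure_iff hf hg).1 (hφ.integrable (by norm_num)))
    fun t ht => ?_
  rw [← hswap fun l : ℝ => Complex.exp (Complex.I * t * l)]
  exact hφO t ht

/-! ### Rescaling to Mathlib's Fourier transform -/

theorem quasiMeasurePreserving_mul_left {c : ℝ} (hc : c ≠ 0) :
    Measure.QuasiMeasurePreserving (fun u : ℝ => c * u) :=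
  ⟨measurable_const_mul c, by
    rw [Real.map_volume_mul_left hc]
    exact Measure.smul_absolutelyContinuous⟩

/-- The dilation by `-2π` is the one relating `hatL2` to `𝓕`; the constant in front is its Jacobian.
-/
theorem fourierInv_comp_mul (Φ : ℝ → ℂ) (t : ℝ) :
    𝓕⁻ (fun u => Φ (-(2 * Real.pi) * u)) t = |(-(2 * Real.pi))⁻¹| •
      conj (∫ l : ℝ, Complex.exp (Complex.I * t * l) * conj (Φ l)) := by
  rw [← integral_conj, ← Measure.integral_comp_mul_left
    (fun l : ℝ => conj (Complex.exp (Complex.I * t * l) * conj (Φ l))), Real.fourierInv_eq']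
  refine integral_congr_ae (.of_forall fun u => ?_)
  simp only [map_mul, ← Complex.exp_conj, Complex.conj_I, Complex.conj_ofReal,
    Complex.conj_conj, smul_eq_mul]
  congr 2
  simp
  ring

theorem hatL2_comp_mul (x : L2R) (u : ℝ) : hatL2 x (-(2 * Real.pi) * u) = (𝓕 x : L2R) u := by
  rw [hatL2]
  congr 1
  field_simp

theorem integrable_fourier_iff_hatL2 (x : L2R) :
    Integrable (𝓕 x : L2R) ↔ Integrable (hatL2 x) := by
  rw [← integrable_comp_mul_left_iff (hatL2 x) (neg_ne_zero.2 Real.two_pi_pos.ne')]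
  simp_rw [hatL2_comp_mul]

/-- A bounded function orthogonal to the integrable Fourier transforms of the elements of `L_2(T)` is
orthogonal to all integrable functions with vanishing Fourier coefficients off `T`. -/
theorem integral_mul_conj_eq_zero_of_hatL2 {T : Set ℝ} {h : ℝ → ℂ} {M : ℝ}
    (hm : AEStronglyMeasurable h) (hb : ∀ᵐ l, ‖h l‖ ≤ M)
    (hψ : ∀ ψ ∈ L2On T, Integrable (hatL2 ψ) → ∫ l, h l * conj (hatL2 ψ l) = 0)
    {Φ : ℝ → ℂ} (hΦ : Integrable Φ)
    (hΦT : ∀ t ∈ Tᶜ, ∫ l : ℝ, Complex.exp (Complex.I * t * l) * conj (Φ l) = 0) :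
    ∫ l, h l * conj (Φ l) = 0 := by
  have hc : -(2 * Real.pi) ≠ 0 := neg_ne_zero.2 Real.two_pi_pos.ne'
  have hq := quasiMeasurePreserving_mul_left hc
  have hcinv : |(-(2 * Real.pi))⁻¹| ≠ 0 := abs_ne_zero.2 (inv_ne_zero hc)
  have key := integral_mul_conj_eq_zero (O := Tᶜ)
    (H := fun u => h (-(2 * Real.pi) * u)) (Φ := fun u => Φ (-(2 * Real.pi) * u)) (M := M)
    (hm.comp_quasiMeasurePreserving hq) (hq.ae hb) ?_ (hΦ.comp_mul_left' hc) ?_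
  · rw [Measure.integral_comp_mul_left (fun l => h l * conj (Φ l))] at key
    exact (smul_eq_zero.1 key).resolve_left hcinv
  · intro ψ hψO hψi
    simp_rw [← hatL2_comp_mul]
    rw [Measure.integral_comp_mul_left (fun l => h l * conj (hatL2 ψ l)), hψ ψ hψO, smul_zero]
    exact (integrable_fourier_iff_hatL2 ψ).1 hψi
  · intro t ht
    rw [fourierInv_comp_mul, hΦT t ht, map_zero, smul_zero]

theorem aestronglyMeasurable_hatL2 (x : L2R) : AEStronglyMeasurable (hatL2 x) := by
  have hc : -(2 * Real.pi)⁻¹ ≠ 0 := neg_ne_zero.2 (inv_ne_zero Real.two_pi_pos.ne')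
  have h := (Lp.aestronglyMeasurable (𝓕 x : L2R)).comp_quasiMeasurePreserving
    (quasiMeasurePreserving_mul_left hc)
  refine h.congr (.of_forall fun l => ?_)
  simp only [hatL2, Function.comp]
  congr 1
  ring

/-- The Fourier coefficients off `T` of `x̂` vanish for `x ∈ L_2(T)` with `x̂` integrable. -/
theorem integral_exp_mul_conj_hatL2_eq_zero {T : Set ℝ} (hT : IsOpen Tᶜ) {x : L2R}
    (hx : x ∈ L2On T) (hi : Integrable (hatL2 x)) {t : ℝ} (ht : t ∈ Tᶜ) :
    ∫ l : ℝ, Complex.exp (Complex.I * t * l) * conj (hatL2 x l) = 0 := by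
  have hFi := (integrable_fourier_iff_hatL2 x).2 hi
  have h1 := fourierInv_toLp_ae_eq (Lp.memLp (𝓕 x : L2R)) hFi
  rw [Lp.toLp_coeFn, FourierTransform.fourierInv_fourier_eq] at h1
  have h2 : 𝓕⁻ ((𝓕 x : L2R) : ℝ → ℂ) =ᵐ[volume.restrict Tᶜ] fun _ => 0 := by
    filter_upwards [ae_restrict_of_ae h1, ae_restrict_of_ae hx, ae_restrict_mem hT.measurableSet]
      with u hu1 hu2 hu3
    rw [← hu1, hu2 hu3]
  -- The coefficients must vanish at every `t` off `T`, not just almost every one: both sides are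
  -- continuous and the complement of `T` is open.
  have h3 := Measure.eqOn_open_of_ae_eq h2 hT (continuous_fourierInv hFi).continuousOn
    continuousOn_const ht
  simp_rw [← funext (hatL2_comp_mul x)] at h3
  rw [fourierInv_comp_mul] at h3
  have h4 := (smul_eq_zero.1 h3).resolve_left
    (abs_ne_zero.2 (inv_ne_zero (neg_ne_zero.2 Real.two_pi_pos.ne')))
  exact (map_eq_zero _).1 h4

theorem hatL2_neg_ae_eq_symbolA {E : Set ℝ} (hE : MeasurableSet E) {a : ℝ → ℂ}
    (ha : IntegrableOn a E) (ha2 : MemLp (E.indicator a) 2) :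
    ∀ᵐ l, hatL2 ha2.toLp (-l) = symbolA E a l := by
  have hc : (2 * Real.pi)⁻¹ ≠ 0 := inv_ne_zero Real.two_pi_pos.ne'
  have h := (quasiMeasurePreserving_mul_left hc).ae
    (fourier_toLp_ae_eq ha2 (ha.integrable_indicator hE))
  filter_upwards [h] with l hl
  have h1 : hatL2 ha2.toLp (-l) = (𝓕 (ha2.toLp (E.indicator a)) : L2R) ((2 * Real.pi)⁻¹ * l) := by
    rw [hatL2]
    congr 1
    ring
  rw [h1, hl, Real.fourier_real_eq_integral_exp_smul, symbolA, ← integral_indicator hE]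
  refine integral_congr_ae (.of_forall fun t => ?_)
  simp only [Set.indicator, smul_eq_mul]
  split_ifs
  · rw [mul_comm]
    congr 2
    push_cast
    have : (Real.pi : ℂ) ≠ 0 := by exact_mod_cast Real.pi_ne_zero
    field_simp
  · rw [mul_zero]

theorem norm_symbolA_le (E : Set ℝ) (a : ℝ → ℂ) (l : ℝ) :
    ‖symbolA E a l‖ ≤ ∫ t in E, ‖a t‖ := by
  refine (norm_integral_le_integral_norm _).trans_eq ?_
  refine integral_congr_ae (.of_forall fun t => ?_)
  have : -(Complex.I * t * l) = ((-(t * l) : ℝ) : ℂ) * Complex.I := by push_cast; ring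
  simp only
  rw [norm_mul, this, Complex.norm_exp_ofReal_mul_I, mul_one]

theorem measurableSet_functionalSet (s : ℕ) (N K : ℕ → ℝ) :
    MeasurableSet (functionalSet s N K) :=
  measurableSet_Ici.diff (Finset.measurableSet_biUnion _ fun _ _ => measurableSet_Icc)

theorem compl_timeT (s : ℕ) (N K : ℕ → ℝ) : (timeT s N K)ᶜ = observed s N K := by
  ext t
  simp [timeT, observed, and_comm]

theorem isOpen_compl_timeT (s : ℕ) (N K : ℕ → ℝ) : IsOpen (timeT s N K)ᶜ :=
  (((Finset.Icc 1 s).finite_toSet.isClosed_biUnion fun _ _ => isClosed_Icc).union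
    isClosed_Ici).isOpen_compl

/-! ### Consequences of the minimality condition -/

/-- The restriction to the line is real analytic and not identically zero, so its zeros are isolated
and form a null set. -/
theorem ae_ne_zero_of_entire {Γ : ℂ → ℂ} (hΓ : Differentiable ℂ Γ) (hne : ∃ l : ℝ, Γ l ≠ 0) :
    ∀ᵐ l : ℝ, Γ l ≠ 0 := by
  obtain ⟨l₀, hl₀⟩ := hne
  have han : AnalyticOnNhd ℝ (fun l : ℝ => Γ l) Set.univ := fun l _ =>
    (hΓ.analyticAt (l : ℂ)).restrictScalars.comp (Complex.ofRealCLM.analyticAt l)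
  have h := han.preimage_zero_mem_codiscrete (x := l₀) hl₀
  have h' := ae_restrict_le_codiscreteWithin (μ := volume) (MeasurableSet.univ (α := ℝ)) h
  rw [Measure.restrict_univ] at h'
  exact h'

/-- Where `f + g = 0` and `Γ ≠ 0` the quotient is infinite, which a finite integral allows only on a
null set. -/
theorem Minimality.ae_pos {f g : ℝ → ℝ} (hf : IsSpectralDensity f) (hg : IsSpectralDensity g)
    (hmin : Minimality f g) : ∀ᵐ l, 0 < f l + g l := by
  obtain ⟨-, Γ, -, hΓ, -, -, hne, hfin⟩ := hmin
  have hm : AEMeasurable fun l : ℝ => ‖Γ l‖ₑ ^ 2 / ENNReal.ofReal (f l + g l) := by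
    refine AEMeasurable.div ?_ (aemeasurable_specDensity hf hg)
    exact (hΓ.continuous.comp Complex.continuous_ofReal).enorm.measurable.pow_const 2
      |>.aemeasurable
  filter_upwards [ae_lt_top' hm hfin.ne, ae_ne_zero_of_entire hΓ hne] with l h1 h2
  by_contra hle
  rw [ENNReal.ofReal_of_nonpos (not_lt.1 hle), ENNReal.div_zero] at h1
  · exact lt_irrefl _ h1
  · exact pow_ne_zero _ (enorm_ne_zero.2 h2)

/-! ### The mean-square error -/

theorem mse_eq_ofReal_integral {A h : ℝ → ℂ} {f g : ℝ → ℝ} (hf : IsSpectralDensity f)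
    (hg : IsSpectralDensity g)
    (hi : Integrable fun l => ‖A l - h l‖ ^ 2 * f l + ‖h l‖ ^ 2 * g l) :
    mse A h f g = ENNReal.ofReal (1 / (2 * Real.pi)) *
      ENNReal.ofReal (∫ l, (‖A l - h l‖ ^ 2 * f l + ‖h l‖ ^ 2 * g l)) := by
  have h0 := hf.1
  have h1 := hg.1
  rw [mse, ofReal_integral_eq_lintegral_ofReal hi
    (.of_forall fun l => add_nonneg (mul_nonneg (sq_nonneg _) (h0 l))
      (mul_nonneg (sq_nonneg _) (h1 l)))]
  congr 1
  refine lintegral_congr fun l => ?_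
  rw [ENNReal.ofReal_add (mul_nonneg (sq_nonneg _) (h0 l)) (mul_nonneg (sq_nonneg _) (h1 l)),
    ENNReal.ofReal_mul (sq_nonneg _), ENNReal.ofReal_mul (sq_nonneg _),
    ENNReal.ofReal_pow (norm_nonneg _), ENNReal.ofReal_pow (norm_nonneg _), ofReal_norm,
    ofReal_norm]

theorem integrable_sq_mul_of_bounded {h : ℝ → ℂ} {M : ℝ} (hm : AEStronglyMeasurable h)
    (hb : ∀ᵐ l, ‖h l‖ ≤ M) {f : ℝ → ℝ} (hf : Integrable f) :
    Integrable fun l => ‖h l‖ ^ 2 * f l := by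
  refine hf.bdd_mul (c := M ^ 2) (hm.norm.pow 2) ?_
  filter_upwards [hb] with l hl
  rw [norm_pow, norm_norm]
  gcongr

/-- Positivity of `f + g` makes Lebesgue measure absolutely continuous with respect to `specMeasure
f g`, so `h` is also Lebesgue measurable. The bound is `|A - h|² ≤ 2|A|² + 2|h|²`. -/
theorem integrable_mse_of_memLp {A h : ℝ → ℂ} {MA : ℝ} {f g : ℝ → ℝ}
    (hf : IsSpectralDensity f) (hg : IsSpectralDensity g) (hpos : ∀ᵐ l, 0 < f l + g l)
    (hA : AEStronglyMeasurable A) (hAb : ∀ᵐ l, ‖A l‖ ≤ MA) (hh : MemLp h 2 (specMeasure f g)) :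
    Integrable fun l => ‖A l - h l‖ ^ 2 * f l + ‖h l‖ ^ 2 * g l := by
  have hac : volume ≪ specMeasure f g :=
    withDensity_absolutelyContinuous' (aemeasurable_specDensity hf hg)
      (hpos.mono fun l hl => by simpa using hl)
  have hhm : AEStronglyMeasurable h := hh.1.mono_ac hac
  have h1 := (integrable_specMeasure_iff hf hg).1 ((memLp_two_iff_integrable_sq_norm hh.1).1 hh)
  have h2 := integrable_sq_mul_of_bounded hA hAb hf.2
  refine ((h2.const_mul 2).add (h1.const_mul 2)).mono'
    ((((hA.sub hhm).norm.pow 2).mul hf.2.1).add ((hhm.norm.pow 2).mul hg.2.1))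
    (.of_forall fun l => ?_)
  have hfl := hf.1 l
  have hgl := hg.1 l
  rw [Real.norm_of_nonneg (by positivity)]
  have h3 : ‖A l - h l‖ ^ 2 ≤ 2 * ‖A l‖ ^ 2 + 2 * ‖h l‖ ^ 2 := by
    have := pow_le_pow_left₀ (norm_nonneg _) (norm_sub_le (A l) (h l)) 2
    nlinarith [sq_nonneg (‖A l‖ - ‖h l‖)]
  have h4 := mul_le_mul_of_nonneg_right h3 hfl
  have h5 : 0 ≤ ‖h l‖ ^ 2 * g l := by positivity
  simp only [Pi.add_apply, smul_eq_mul]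
  linarith

/-- The error at `k` expanded about `h`: the quadratic term is nonnegative, and the linear term is
the one that the orthogonality principle removes. -/
theorem sq_norm_sub_expansion (A h k : ℂ) (f g : ℝ) :
    ‖A - k‖ ^ 2 * f + ‖k‖ ^ 2 * g = ‖A - h‖ ^ 2 * f + ‖h‖ ^ 2 * g + ‖k - h‖ ^ 2 * (f + g)
      - 2 * ((k - h) * conj (A * f - h * ((f + g : ℝ) : ℂ))).re := by
  simp only [← Complex.normSq_eq_norm_sq, Complex.normSq_apply, Complex.sub_re, Complex.sub_im,
    Complex.mul_re, Complex.mul_im, Complex.conj_re, Complex.conj_im, Complex.ofReal_re,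
    Complex.ofReal_im]
  ring

/-- The orthogonality principle: if `A f - h (f+g)` is orthogonal to the exponentials `e^{itλ}`,
`t ∈ O`, then `h` is optimal. -/
theorem IsOptimal.of_orthogonal {O : Set ℝ} {A h : ℝ → ℂ} {MA : ℝ} {f g : ℝ → ℝ}
    (hf : IsSpectralDensity f) (hg : IsSpectralDensity g) (hpos : ∀ᵐ l, 0 < f l + g l)
    (hA : AEStronglyMeasurable A) (hAb : ∀ᵐ l, ‖A l‖ ≤ MA) (hh : MemL2s O f g h)
    {φ : ℝ → ℂ} (hφ : MemLp φ 2 (specMeasure f g))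
    (hφA : ∀ᵐ l, ((f l + g l : ℝ) : ℂ) * φ l = A l * f l - h l * ((f l + g l : ℝ) : ℂ))
    (hφO : ∀ t ∈ O,
      ∫ l : ℝ, Complex.exp (Complex.I * t * l) * conj (φ l) ∂specMeasure f g = 0) :
    IsOptimal O A f g h := by
  refine ⟨hh, fun k hk => ?_⟩
  have hih := integrable_mse_of_memLp hf hg hpos hA hAb hh.1
  have hik := integrable_mse_of_memLp hf hg hpos hA hAb hk.1
  rw [mse_eq_ofReal_integral hf hg hih, mse_eq_ofReal_integral hf hg hik]
  refine mul_le_mul_right (ENNReal.ofReal_le_ofReal ?_) _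
  have hprod : ∀ y : ℝ → ℂ, MemLp y 2 (specMeasure f g) →
      Integrable (fun l => y l * conj (φ l)) (specMeasure f g) := fun y hy => by
    have := hy.integrable_mul hφ.star
    exact this
  have hcross : ∫ l, (k l - h l) * conj (φ l) ∂specMeasure f g = 0 := by
    simp_rw [sub_mul]
    rw [integral_sub (hprod k hk.1) (hprod h hh.1), hk.integral_mul_conj_eq_zero hf hg hφ hφO,
      hh.integral_mul_conj_eq_zero hf hg hφ hφO, sub_zero]
  rw [integral_specMeasure hf hg] at hcross
  have hcrossi := (integrable_specMeasure_iff hf hg).1 (hprod _ (hk.1.sub hh.1))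
  simp only [Complex.real_smul, Pi.sub_apply] at hcrossi
  have hcrossr : Integrable fun l =>
      (((f l + g l : ℝ) : ℂ) * ((k l - h l) * conj (φ l))).re := hcrossi.re
  have hre : ∫ l, (((f l + g l : ℝ) : ℂ) * ((k l - h l) * conj (φ l))).re = 0 := by
    have := integral_re hcrossi
    simp only [RCLike.re_to_complex] at this
    rw [this, hcross, Complex.zero_re]
  calc ∫ l, (‖A l - h l‖ ^ 2 * f l + ‖h l‖ ^ 2 * g l)
      = ∫ l, ((‖A l - h l‖ ^ 2 * f l + ‖h l‖ ^ 2 * g l) -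
          2 * (((f l + g l : ℝ) : ℂ) * ((k l - h l) * conj (φ l))).re) := by
        rw [integral_sub hih (hcrossr.const_mul 2), integral_const_mul, hre]
        simp
    _ ≤ ∫ l, (‖A l - k l‖ ^ 2 * f l + ‖k l‖ ^ 2 * g l) := by
        refine integral_mono_ae (hih.sub (hcrossr.const_mul 2)) hik ?_
        filter_upwards [hφA] with l hl
        have h1 : ((f l + g l : ℝ) : ℂ) * ((k l - h l) * conj (φ l)) =
            (k l - h l) * conj (A l * f l - h l * ((f l + g l : ℝ) : ℂ)) := by
          rw [← hl, map_mul, Complex.conj_ofReal]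
          ring
        rw [h1, sq_norm_sub_expansion (A l) (h l) (k l)]
        have := mul_nonneg (sq_nonneg ‖k l - h l‖) (add_nonneg (hf.1 l) (hg.1 l))
        linarith

/-! ### The saddle point inequality -/

/-- The weight satisfies `p ≤ α²` everywhere, while `p (f₀ - f₁) = α² |f₀ - f₁|`. Hence `∫ p (f -
f₀)` is at most `α²` times the difference of the two `L_1` distances to `f₁`, and `f₀` attains the
largest one allowed. -/
theorem integral_mul_le_of_mem_ballOne {p f₁ f₀ f Ψ : ℝ → ℝ} {ε α : ℝ}
    (hf₁ : Integrable f₁) (hf₀ : f₀ ∈ ballOne f₁ ε) (hf : f ∈ ballOne f₁ ε)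
    (hnorm : 1 / (2 * Real.pi) * ∫ l, |f₀ l - f₁ l| = ε)
    (hpf : Integrable fun l => p l * f l) (hpf₀ : Integrable fun l => p l * f₀ l)
    (hΨ : ∀ l, |Ψ l| ≤ 1) (hΨs : ∀ l, f₀ l ≠ f₁ l → Ψ l = Real.sign (f₀ l - f₁ l))
    (hp : ∀ᵐ l, p l = (Ψ l * α) ^ 2 ∧ 0 ≤ Ψ l * α) (hα : 0 ≤ α) :
    ∫ l, p l * f l ≤ ∫ l, p l * f₀ l := by
  have hi : Integrable fun l => |f l - f₁ l| := (hf.1.2.sub hf₁).abs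
  have hi₀ : Integrable fun l => |f₀ l - f₁ l| := (hf₀.1.2.sub hf₁).abs
  have hle : ∫ l, |f l - f₁ l| ≤ ∫ l, |f₀ l - f₁ l| :=
    le_of_mul_le_mul_left (hf.2.trans_eq hnorm.symm) (by positivity)
  have hmain : ∫ l, (p l * f l - p l * f₀ l) ≤
      ∫ l, (α ^ 2 * |f l - f₁ l| - α ^ 2 * |f₀ l - f₁ l|) := by
    refine integral_mono_ae (hpf.sub hpf₀) ((hi.const_mul _).sub (hi₀.const_mul _)) ?_
    filter_upwards [hp] with l hl
    obtain ⟨hl, hs⟩ := hl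
    have hp0 : 0 ≤ p l := hl ▸ sq_nonneg _
    have hpα : p l ≤ α ^ 2 := by
      rw [hl, mul_pow]
      have := (sq_le_one_iff_abs_le_one (Ψ l)).2 (hΨ l)
      exact mul_le_of_le_one_left (sq_nonneg _) this
    have h1 : p l * (f l - f₁ l) ≤ α ^ 2 * |f l - f₁ l| :=
      (mul_le_mul_of_nonneg_left (le_abs_self _) hp0).trans
        (mul_le_mul_of_nonneg_right hpα (abs_nonneg _))
    have h2 : p l * (f₀ l - f₁ l) = α ^ 2 * |f₀ l - f₁ l| := by
      rcases lt_trichotomy (f₀ l) (f₁ l) with hlt | heq | hgt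
      · have hsg : Ψ l = -1 := by rw [hΨs l hlt.ne, Real.sign_of_neg (sub_neg.2 hlt)]
        -- Below `f₁` the multiplier `Ψ α = -α` is also a norm, so it can only be zero.
        have hα0 : α = 0 := by rw [hsg] at hs; linarith
        rw [hl, hα0]
        simp
      · simp [heq]
      · have hsg : Ψ l = 1 := by rw [hΨs l hgt.ne', Real.sign_of_pos (sub_pos.2 hgt)]
        rw [hl, hsg, abs_of_pos (sub_pos.2 hgt), one_mul]
    linarith
  rw [integral_sub hpf hpf₀, integral_sub (hi.const_mul _) (hi₀.const_mul _),
    integral_const_mul, integral_const_mul] at hmain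
  have := mul_le_mul_of_nonneg_left hle (sq_nonneg α)
  linarith

theorem integral_mul_le_of_mem_ballTwo {q g₁ g₀ g : ℝ → ℝ} {ε α : ℝ}
    (hg₀ : g₀ ∈ ballTwo g₁ ε) (hg : g ∈ ballTwo g₁ ε)
    (hnorm : 1 / (2 * Real.pi) * ∫ l, |g₀ l - g₁ l| ^ 2 = ε)
    (hqg : Integrable fun l => q l * g l) (hqg₀ : Integrable fun l => q l * g₀ l)
    (hq : ∀ᵐ l, q l = (g₀ l - g₁ l) * α) (hα : 0 ≤ α) :
    ∫ l, q l * g l ≤ ∫ l, q l * g₀ l := by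
  have hsq : ∀ {g}, g ∈ ballTwo g₁ ε → Integrable fun l => |g l - g₁ l| ^ 2 := fun hg => by
    simpa using (memLp_two_iff_integrable_sq_norm hg.2.1.1).1 hg.2.1
  have hi := hsq hg
  have hi₀ := hsq hg₀
  have hle : ∫ l, |g l - g₁ l| ^ 2 ≤ ∫ l, |g₀ l - g₁ l| ^ 2 :=
    le_of_mul_le_mul_left (hg.2.2.trans_eq hnorm.symm) (by positivity)
  have hmain : ∫ l, (q l * g l - q l * g₀ l) ≤
      ∫ l, (α / 2 * |g l - g₁ l| ^ 2 - α / 2 * |g₀ l - g₁ l| ^ 2) := by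
    refine integral_mono_ae (hqg.sub hqg₀) ((hi.const_mul _).sub (hi₀.const_mul _)) ?_
    filter_upwards [hq] with l hl
    simp only [hl, sq_abs]
    -- Tangent inequality for the square: the two sides differ by exactly `α/2 (g - g₀)²`.
    nlinarith [mul_nonneg hα (sq_nonneg (g l - g₀ l))]
  rw [integral_sub hqg hqg₀, integral_sub (hi.const_mul _) (hi₀.const_mul _),
    integral_const_mul, integral_const_mul] at hmain
  have := mul_le_mul_of_nonneg_left hle (div_nonneg hα zero_le_two)
  linarith

/-! ### From a saddle point to minimax robustness -/

/-- Both claims are chains through the saddle value: `Δ(f, g) ≤ Δ(h₀; f, g) ≤ Δ(h₀; f₀, g₀) = Δ(f₀,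
g₀)`, and `Δ(h₀; f₀, g₀) ≤ Δ(h; f₀, g₀) ≤ sup Δ(h; ·)`. -/
theorem isLeastFavorable_and_isMinimaxRobust {O : Set ℝ} {A h₀ : ℝ → ℂ} {Df Dg : Set (ℝ → ℝ)}
    {f₀ g₀ : ℝ → ℝ} (hf₀ : f₀ ∈ Df) (hg₀ : g₀ ∈ Dg) (hH : h₀ ∈ classH O Df Dg)
    (hopt : IsOptimal O A f₀ g₀ h₀)
    (hsaddle : ∀ f ∈ Df, ∀ g ∈ Dg, mse A h₀ f g ≤ mse A h₀ f₀ g₀) :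
    IsLeastFavorable O A Df Dg f₀ g₀ ∧ IsMinimaxRobust O A Df Dg h₀ := by
  refine ⟨⟨hf₀, hg₀, fun f hf g hg => ?_⟩, hH, mse A h₀ f₀ g₀, ⟨⟨f₀, hf₀, g₀, hg₀, rfl⟩, ?_⟩, ?_⟩
  · exact (iInf₂_le h₀ (hH f hf g hg)).trans
      ((hsaddle f hf g hg).trans (le_iInf₂ fun k hk => hopt.2 k hk))
  · rintro e ⟨f, hf, g, hg, rfl⟩
    exact hsaddle f hf g hg
  · intro h hh
    refine (hopt.2 h (hh f₀ hf₀ g₀ hg₀)).trans ?_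
    exact le_iSup₂_of_le f₀ hf₀ (le_iSup₂_of_le g₀ hg₀ le_rfl)

/-! ### The spectral characteristic -/

theorem sub_specChar {A C : ℝ → ℂ} {f g : ℝ → ℝ} {l : ℝ} (h : 0 < f l + g l) :
    A l - specChar A C f g l = (A l * g l + C l) / ((f l + g l : ℝ) : ℂ) := by
  have : ((f l + g l : ℝ) : ℂ) ≠ 0 := by exact_mod_cast h.ne'
  rw [specChar, Complex.ofReal_div]
  field_simp
  push_cast
  ring

theorem specChar_eq_div (A C : ℝ → ℂ) (f g : ℝ → ℝ) (l : ℝ) :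
    specChar A C f g l = (A l * f l - C l) / ((f l + g l : ℝ) : ℂ) := by
  rw [specChar, Complex.ofReal_div]
  ring

/-- Pointwise `|C| ≤ |C|²/(f+g) + (f+g)`. For `C = ĉ` this lets the Fourier coefficients of `C` be
computed by absolutely convergent integrals. -/
theorem integrable_of_sq_div {C : ℝ → ℂ} {f g : ℝ → ℝ} (hf : Integrable f) (hg : Integrable g)
    (hpos : ∀ᵐ l, 0 < f l + g l) (hm : AEStronglyMeasurable C)
    (hC : Integrable fun l => ‖C l‖ ^ 2 / (f l + g l)) : Integrable C := by
  refine (hC.add (hf.add hg)).mono' hm ?_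
  filter_upwards [hpos] with l hl
  simp only [Pi.add_apply]
  rw [div_add' _ _ _ hl.ne', le_div_iff₀ hl]
  nlinarith [sq_nonneg (‖C l‖ - (f l + g l)), mul_nonneg (norm_nonneg (C l)) hl.le]

/-- The equation `B c = R a` says that `h = A f/(f+g) - C/(f+g)` is orthogonal to the integrable
Fourier transforms of the elements of `L_2(T)`. -/
theorem integral_specChar_mul_conj_hatL2 {T : Set ℝ} {f g : ℝ → ℝ} (hf : IsSpectralDensity f)
    (hg : IsSpectralDensity g) {a r c : L2R} (hR : IsR T f g a r) (hB : IsB T f g c r)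
    {A : ℝ → ℂ} {MA : ℝ} (hA : ∀ᵐ l, hatL2 a (-l) = A l) (hAm : AEStronglyMeasurable A)
    (hAb : ∀ᵐ l, ‖A l‖ ≤ MA) {ψ : L2R} (hψ : ψ ∈ L2On T) (hψi : Integrable (hatL2 ψ)) :
    ∫ l, specChar A (hatL2 c) f g l * conj (hatL2 ψ l) = 0 := by
  have h1 := hR.2.2 ψ hψ
  obtain ⟨hi, h2⟩ := hB.2.2.2 ψ hψ hψi
  have hψc : Integrable fun l => conj (hatL2 ψ l) :=
    hψi.congr' (Complex.continuous_conj.comp_aestronglyMeasurable hψi.1)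
      (.of_forall fun l => (RCLike.norm_conj _).symm)
  have hfm : AEStronglyMeasurable fun l => ((f l / (f l + g l) : ℝ) : ℂ) :=
    Complex.continuous_ofReal.comp_aestronglyMeasurable
      (hf.2.1.aemeasurable.div (hf.2.1.aemeasurable.add hg.2.1.aemeasurable)).aestronglyMeasurable
  have hi' : Integrable fun l => A l * ((f l / (f l + g l) : ℝ) : ℂ) * conj (hatL2 ψ l) := by
    refine hψc.bdd_mul (c := MA) (hAm.mul hfm) ?_
    filter_upwards [hAb] with l hl
    rw [norm_mul, Complex.norm_real,
      Real.norm_of_nonneg (div_nonneg (hf.1 l) (add_nonneg (hf.1 l) (hg.1 l)))]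
    refine (mul_le_of_le_one_right (norm_nonneg _) ?_).trans hl
    exact div_le_one_of_le₀ (le_add_of_nonneg_right (hg.1 l)) (add_nonneg (hf.1 l) (hg.1 l))
  have h3 : ∫ l, A l * ((f l / (f l + g l) : ℝ) : ℂ) * conj (hatL2 ψ l) =
      ∫ l, ((f l / (f l + g l) : ℝ) : ℂ) * hatL2 a (-l) * conj (hatL2 ψ l) := by
    refine integral_congr_ae ?_
    filter_upwards [hA] with l hl
    rw [hl, mul_comm (A l)]
  have hpi : (1 / (2 * Real.pi) : ℂ) ≠ 0 := by
    have : (Real.pi : ℂ) ≠ 0 := by exact_mod_cast Real.pi_ne_zero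
    simp [this]
  have h4 : ∀ l, specChar A (hatL2 c) f g l * conj (hatL2 ψ l) =
      A l * ((f l / (f l + g l) : ℝ) : ℂ) * conj (hatL2 ψ l) -
        hatL2 c l * conj (hatL2 ψ l) / ((f l + g l : ℝ) : ℂ) := fun l => by
    rw [specChar]
    ring
  simp_rw [h4]
  rw [integral_sub hi' hi, h3, mul_left_cancel₀ hpi (h1.trans h2.symm), sub_self]

/-- The residual `A f - h (f+g)` equals `ĉ`, whose coefficients off `T` vanish. The finite quadratic
form in `IsB` is exactly the statement that `φ = ĉ/(f+g)` lies in `L_2(f+g)`. -/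
theorem specChar_isOptimal {T : Set ℝ} (hT : IsOpen Tᶜ) {f g : ℝ → ℝ}
    (hf : IsSpectralDensity f) (hg : IsSpectralDensity g) (hpos : ∀ᵐ l, 0 < f l + g l)
    {r c : L2R} (hB : IsB T f g c r) {A : ℝ → ℂ} {MA : ℝ} (hAm : AEStronglyMeasurable A)
    (hAb : ∀ᵐ l, ‖A l‖ ≤ MA) (hh : MemL2s Tᶜ f g (specChar A (hatL2 c) f g)) :
    IsOptimal Tᶜ A f g (specChar A (hatL2 c) f g) := by
  have hCm := aestronglyMeasurable_hatL2 c
  have hCi := integrable_of_sq_div hf.2 hg.2 hpos hCm hB.2.2.1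
  set φ : ℝ → ℂ := fun l => hatL2 c l / ((f l + g l : ℝ) : ℂ) with hφdef
  have hFm : AEMeasurable fun l => ((f l + g l : ℝ) : ℂ) :=
    (hf.2.1.aemeasurable.add hg.2.1.aemeasurable).complex_ofReal
  have hφm : AEStronglyMeasurable φ := (hCm.aemeasurable.div hFm).aestronglyMeasurable
  have hφF : ∀ᵐ l, ((f l + g l : ℝ) : ℂ) * φ l = hatL2 c l := by
    filter_upwards [hpos] with l hl
    have : ((f l + g l : ℝ) : ℂ) ≠ 0 := by exact_mod_cast hl.ne'
    rw [hφdef]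
    field_simp
  refine .of_orthogonal hf hg hpos hAm hAb hh (φ := φ) ?_ ?_ fun t ht => ?_
  · rw [memLp_two_iff_integrable_sq_norm (hφm.mono_ac specMeasure_absolutelyContinuous),
      integrable_specMeasure_iff hf hg]
    refine hB.2.2.1.congr ?_
    filter_upwards [hpos] with l hl
    rw [hφdef]
    simp only [norm_div, Complex.norm_real, smul_eq_mul, div_pow]
    rw [Real.norm_of_nonneg hl.le]
    field_simp
  · filter_upwards [hφF, hpos] with l hl hl'
    have : ((f l + g l : ℝ) : ℂ) ≠ 0 := by exact_mod_cast hl'.ne'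
    rw [hl, specChar_eq_div, div_mul_cancel₀ _ this]
    ring
  · rw [integral_specMeasure hf hg, ← integral_exp_mul_conj_hatL2_eq_zero hT hB.1 hCi ht]
    refine integral_congr_ae ?_
    filter_upwards [hφF] with l hl
    rw [← hl, map_mul, Complex.conj_ofReal]
    ring

end MissingFilter

theorem mainTheorem3
    (s : ℕ) (N K : ℕ → ℝ) (hN0 : N 0 = 0) (hK0 : K 0 = 0)
    (hN : ∀ l, 0 ≤ N l) (hK : ∀ l, 0 ≤ K l)
    (a : ℝ → ℂ)
    (ha1 : IntegrableOn a (MissingFilter.functionalSet s N K))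
    (ha2 : IntegrableOn (fun t => t * ‖a t‖ ^ 2) (MissingFilter.functionalSet s N K))
    (haL2 : MemLp ((MissingFilter.functionalSet s N K).indicator a) 2 volume)
    (A : ℝ → ℂ) (hA : A = MissingFilter.symbolA (MissingFilter.functionalSet s N K) a)
    (T O : Set ℝ) (hT : T = MissingFilter.timeT s N K) (hO : O = MissingFilter.observed s N K)
    (f₁ g₁ : ℝ → ℝ) (hf₁ : MissingFilter.IsSpectralDensity f₁)
    (hg₁ : MissingFilter.IsSpectralDensity g₁) (ε₁ ε₂ : ℝ)
    (f₀ g₀ : ℝ → ℝ) (hf₀ : f₀ ∈ MissingFilter.ballOne f₁ ε₁)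
    (hg₀ : g₀ ∈ MissingFilter.ballTwo g₁ ε₂)
    (hmin : MissingFilter.Minimality f₀ g₀)
    -- `r₀ = R⁰ a`, `c₀ = (B⁰)⁻¹ R⁰ a`, and `C⁰` is the Fourier transform of `c₀`
    (r₀ c₀ : MissingFilter.L2R)
    (hR : MissingFilter.IsR T f₀ g₀ haL2.toLp r₀) (hB : MissingFilter.IsB T f₀ g₀ c₀ r₀)
    (C₀ : ℝ → ℂ) (hC₀ : C₀ = MissingFilter.hatL2 c₀)
    (hbf : MissingFilter.EssBounded (MissingFilter.weightF A C₀ f₀ g₀))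
    (hbg : MissingFilter.EssBounded (MissingFilter.weightG A C₀ f₀ g₀))
    (α₁ α₂ : ℝ) (hα₁ : 0 ≤ α₁) (hα₂ : 0 ≤ α₂)
    (Ψ : ℝ → ℝ) (hΨ : ∀ l, |Ψ l| ≤ 1)
    (hΨs : ∀ l, f₀ l ≠ f₁ l → Ψ l = Real.sign (f₀ l - f₁ l))
    (heqf : ∀ᵐ l, ‖A l * (g₀ l : ℂ) + C₀ l‖ = (f₀ l + g₀ l) * Ψ l * α₁)
    (heqg : ∀ᵐ l, ‖A l * (f₀ l : ℂ) - C₀ l‖ ^ 2 = (f₀ l + g₀ l) ^ 2 * (g₀ l - g₁ l) * α₂)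
    (hnorm₁ : 1 / (2 * Real.pi) * ∫ l, |f₀ l - f₁ l| = ε₁)
    (hnorm₂ : 1 / (2 * Real.pi) * ∫ l, |g₀ l - g₁ l| ^ 2 = ε₂)
    (hext : MissingFilter.SolvesExtremal T (MissingFilter.ballOne f₁ ε₁)
      (MissingFilter.ballTwo g₁ ε₂) haL2.toLp f₀ g₀ r₀ c₀) :
    MissingFilter.IsLeastFavorable O A (MissingFilter.ballOne f₁ ε₁)
        (MissingFilter.ballTwo g₁ ε₂) f₀ g₀ ∧
      MissingFilter.IsOptimal O A f₀ g₀ (MissingFilter.specChar A C₀ f₀ g₀) ∧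
      MissingFilter.IsMinimaxRobust O A (MissingFilter.ballOne f₁ ε₁)
        (MissingFilter.ballTwo g₁ ε₂) (MissingFilter.specChar A C₀ f₀ g₀) := by
  have hf₀' := hf₀.1
  have hg₀' := hg₀.1
  have hpos := hmin.ae_pos hf₀' hg₀'
  have hAhat := MissingFilter.hatL2_neg_ae_eq_symbolA
    (MissingFilter.measurableSet_functionalSet s N K) ha1 haL2
  have hAb := MissingFilter.norm_symbolA_le (MissingFilter.functionalSet s N K) a
  rw [← hA] at hAhat hAb
  have hOT : O = Tᶜ := by rw [hO, hT, MissingFilter.compl_timeT]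
  have hTo : IsOpen Tᶜ := by rw [hT]; exact MissingFilter.isOpen_compl_timeT s N K
  subst hOT hC₀
  set h₀ := MissingFilter.specChar A (MissingFilter.hatL2 c₀) f₀ g₀ with hh₀
  have hAm : AEStronglyMeasurable A := by
    refine AEStronglyMeasurable.congr ?_ hAhat
    exact (MissingFilter.aestronglyMeasurable_hatL2 haL2.toLp).comp_quasiMeasurePreserving
      (Measure.measurePreserving_neg volume).quasiMeasurePreserving
  have hCm := MissingFilter.aestronglyMeasurable_hatL2 c₀
  have hf₀m := hf₀'.2.1.aemeasurable
  have hg₀m := hg₀'.2.1.aemeasurable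
  have hhm : AEStronglyMeasurable h₀ :=
    ((hAm.aemeasurable.mul (hf₀m.div (hf₀m.add hg₀m)).complex_ofReal).sub
      (hCm.aemeasurable.div (hf₀m.add hg₀m).complex_ofReal)).aestronglyMeasurable
  have hG : ∀ᵐ l, ‖h₀ l‖ ^ 2 = (g₀ l - g₁ l) * α₂ := by
    filter_upwards [heqg, hpos] with l hl hl'
    rw [hh₀, MissingFilter.specChar_eq_div, norm_div, div_pow, hl, Complex.norm_real,
      Real.norm_of_nonneg hl'.le]
    field_simp
  have hF : ∀ᵐ l, ‖A l - h₀ l‖ = Ψ l * α₁ := by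
    filter_upwards [heqf, hpos] with l hl hl'
    rw [hh₀, MissingFilter.sub_specChar hl', norm_div, hl, Complex.norm_real,
      Real.norm_of_nonneg hl'.le]
    field_simp
  -- `h_g` is `|h₀|²`, so its essential bound makes `h₀` a bounded function, as the mollification
  -- argument requires.
  obtain ⟨M, hM⟩ := hbg
  have hhb : ∀ᵐ l, ‖h₀ l‖ ≤ Real.sqrt M := by
    filter_upwards [hM, hpos] with l hl hl'
    refine Real.le_sqrt_of_sq_le ((le_abs_self _).trans' ?_ |>.trans hl)
    rw [hh₀, MissingFilter.specChar_eq_div, MissingFilter.weightG, norm_div, div_pow,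
      Complex.norm_real, Real.norm_of_nonneg hl'.le]
  -- The orthogonality of `h₀` refers to Lebesgue measure only, so one equation at `(f₀, g₀)` serves
  -- all pairs of densities.
  have hmem : ∀ f g, MissingFilter.IsSpectralDensity f → MissingFilter.IsSpectralDensity g →
      MissingFilter.MemL2s Tᶜ f g h₀ := fun f g hf hg =>
    .of_bounded hf hg hhm hhb fun Φ hΦ hΦO =>
      MissingFilter.integral_mul_conj_eq_zero_of_hatL2 hhm hhb
        (fun ψ hψ hψi => MissingFilter.integral_specChar_mul_conj_hatL2 hf₀' hg₀' hR hB hAhat hAm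
          (.of_forall hAb) hψ hψi) hΦ hΦO
  have hopt := MissingFilter.specChar_isOptimal hTo hf₀' hg₀' hpos hB hAm (.of_forall hAb)
    (hmem f₀ g₀ hf₀' hg₀')
  have hAhb : ∀ᵐ l, ‖A l - h₀ l‖ ≤ α₁ := by
    filter_upwards [hF] with l hl
    rw [hl]
    exact mul_le_of_le_one_left hα₁ ((le_abs_self _).trans (hΨ l))
  have hpi : ∀ {f}, MissingFilter.IsSpectralDensity f →
      Integrable fun l => ‖A l - h₀ l‖ ^ 2 * f l := fun hf =>
    MissingFilter.integrable_sq_mul_of_bounded (hAm.sub hhm) hAhb hf.2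
  have hqi : ∀ {g}, MissingFilter.IsSpectralDensity g →
      Integrable fun l => ‖h₀ l‖ ^ 2 * g l := fun hg =>
    MissingFilter.integrable_sq_mul_of_bounded hhm hhb hg.2
  obtain ⟨h1, h2⟩ := MissingFilter.isLeastFavorable_and_isMinimaxRobust hf₀ hg₀
    (fun f hf g hg => hmem f g hf.1 hg.1) hopt fun f hf g hg => by
      rw [MissingFilter.mse_eq_ofReal_integral hf.1 hg.1 ((hpi hf.1).add (hqi hg.1)),
        MissingFilter.mse_eq_ofReal_integral hf₀' hg₀' ((hpi hf₀').add (hqi hg₀'))]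
      refine mul_le_mul_right (ENNReal.ofReal_le_ofReal ?_) _
      rw [integral_add (hpi hf.1) (hqi hg.1), integral_add (hpi hf₀') (hqi hg₀')]
      refine add_le_add
        (MissingFilter.integral_mul_le_of_mem_ballOne hf₁.2 hf₀ hf hnorm₁ (hpi hf.1) (hpi hf₀')
          hΨ hΨs (hF.mono fun l hl => ⟨by rw [hl], hl ▸ norm_nonneg _⟩) hα₁)
        (MissingFilter.integral_mul_le_of_mem_ballTwo hg₀ hg hnorm₂ (hqi hg.1) (hqi hg₀') hG hα₂)
  exact ⟨h1, hopt, h2⟩
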